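/- Let $k$ be a field and let $(H,\Delta,\epsilon,\phi,S,\alpha,\beta)$ be a finite-dimensional quasi-Hopf algebra over $k$ with invertible antipode $S$. A left (resp. right) integral in $H$ is an element $l\in H$ with $al=\epsilon(a)l$ (resp. $la=\epsilon(a)l$) for all $a\in H$. The modulus of $H$ is the algebra morphism $\mu=\epsilon\circ\theta_\omega^{-1}:H\to k$, where $\omega:H\to k$ is a nondegenerate linear functional (that is, the bilinear form $(a,b)\mapsto\omega(ab)$ is nondegenerate) and $\theta_\omega$ is the algebra automorphism of $H$ with $\omega(ab)=\omega(b\,\theta_\omega(a))$ for all $a,b\in H$; $\mu$ does not depend on the choice of $\omega$, and $H$ is called unimodular if $\mu=\epsilon$. $H$ is called symmetric if it admits a nondegenerate linear functional $\tau$ with $\tau(ab)=\tau(ba)$ for all $a,b\in H$. Then: (i) The following are equivalent: $H$ is unimodular; some nonzero left integral $l$ satisfies $S(l)=l$; every nonzero left integral $l$ satisfies $S(l)=l$; some nonzero right integral $r$ satisfies $S(r)=r$; every nonzero right integral $r$ satisfies $S(r)=r$. (ii) $H$ is symmetric if and only if $H$ is unimodular and $S^2$ is an inner automorphism, i.e.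 there is an invertible $g\in H$ with $S^2(x)=gxg^{-1}$ for all $x\in H$. -/

import Mathlib

open scoped TensorProduct

/-- A quasi-bialgebra structure on a unital algebra `H` over a field `k`. The threefold tensor
power is `H ⊗ (H ⊗ H)` and the fourfold one is `H ⊗ (H ⊗ (H ⊗ H))`; other bracketings are
transported to these by the associator of the tensor product. -/
class QuasiBialgebra (k H : Type*) [Field k] [Ring H] [Algebra k H] where
  /-- the coproduct `Δ` -/
  comul : H →ₐ[k] H ⊗[k] H
  /-- the counit `ε` -/
  counit : H →ₐ[k] k
  /-- the reassociator `φ` -/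
  phi : (H ⊗[k] (H ⊗[k] H))ˣ
  /-- `(id ⊗ Δ)(Δ a) φ = φ (Δ ⊗ id)(Δ a)` -/
  quasi_coassoc : ∀ a : H,
    Algebra.TensorProduct.map (AlgHom.id k H) comul (comul a) * (phi : H ⊗[k] (H ⊗[k] H)) =
      (phi : H ⊗[k] (H ⊗[k] H)) * Algebra.TensorProduct.assoc k k k H H H
        (Algebra.TensorProduct.map comul (AlgHom.id k H) (comul a))
  /-- `(id ⊗ id ⊗ Δ)(φ) (Δ ⊗ id ⊗ id)(φ) = (1 ⊗ φ) (id ⊗ Δ ⊗ id)(φ) (φ ⊗ 1)` -/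
  pentagon :
    Algebra.TensorProduct.map (AlgHom.id k H)
        (Algebra.TensorProduct.map (AlgHom.id k H) comul) (phi : H ⊗[k] (H ⊗[k] H)) *
      Algebra.TensorProduct.assoc k k k H H (H ⊗[k] H)
        (Algebra.TensorProduct.map comul (AlgHom.id k (H ⊗[k] H))
          (phi : H ⊗[k] (H ⊗[k] H))) =
    ((1 : H) ⊗ₜ[k] (phi : H ⊗[k] (H ⊗[k] H))) *
      Algebra.TensorProduct.map (AlgHom.id k H)
        ((Algebra.TensorProduct.assoc k k k H H H).toAlgHom.comp
          (Algebra.TensorProduct.map comul (AlgHom.id k H))) (phi : H ⊗[k] (H ⊗[k] H)) *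
      Algebra.TensorProduct.map (AlgHom.id k H)
        (Algebra.TensorProduct.assoc k k k H H H).toAlgHom
        (Algebra.TensorProduct.assoc k k k H (H ⊗[k] H) H
          ((phi : H ⊗[k] (H ⊗[k] H)) ⊗ₜ[k] (1 : H)))
  /-- `(ε ⊗ id)(Δ a) = a` -/
  counit_comul : ∀ a : H, Algebra.TensorProduct.lid k H
    (Algebra.TensorProduct.map counit (AlgHom.id k H) (comul a)) = a
  /-- `(id ⊗ ε)(Δ a) = a` -/
  comul_counit : ∀ a : H, Algebra.TensorProduct.rid k k H
    (Algebra.TensorProduct.map (AlgHom.id k H) counit (comul a)) = a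
  /-- `(id ⊗ ε ⊗ id)(φ) = 1 ⊗ 1` -/
  counit_phi :
    Algebra.TensorProduct.map (AlgHom.id k H)
      ((Algebra.TensorProduct.lid k H).toAlgHom.comp
        (Algebra.TensorProduct.map counit (AlgHom.id k H))) (phi : H ⊗[k] (H ⊗[k] H)) = 1

/-- A quasi-Hopf algebra: a quasi-bialgebra with an invertible antipode. We write
`φ = ∑ X ⊗ Y ⊗ Z`, `φ⁻¹ = ∑ X' ⊗ Y' ⊗ Z'` and `Δ a = ∑ a₁ ⊗ a₂`. -/
class QuasiHopfAlgebra (k H : Type*) [Field k] [Ring H] [Algebra k H]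
    extends QuasiBialgebra k H where
  /-- the antipode, a bijective linear map -/
  S : H ≃ₗ[k] H
  S_one : S 1 = 1
  S_mul : ∀ a b : H, S (a * b) = S b * S a
  alpha : H
  beta : H
  /-- `∑ S(a₁) α a₂ = ε(a) α` -/
  S_alpha : ∀ a : H, LinearMap.mul' k H
    (TensorProduct.map (LinearMap.mulRight k alpha ∘ₗ S.toLinearMap) LinearMap.id (comul a)) =
      counit a • alpha
  /-- `∑ a₁ β S(a₂) = ε(a) β` -/
  beta_S : ∀ a : H, LinearMap.mul' k H
    (TensorProduct.map (LinearMap.mulRight k beta) S.toLinearMap (comul a)) = counit a • beta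
  /-- `∑ X β S(Y) α Z = 1` -/
  phi_antipode : LinearMap.mul' k H
    (TensorProduct.map (LinearMap.mulRight k beta)
      (LinearMap.mul' k H ∘ₗ
        TensorProduct.map (LinearMap.mulRight k alpha ∘ₗ S.toLinearMap) LinearMap.id)
      (phi : H ⊗[k] (H ⊗[k] H))) = 1
  /-- `∑ S(X') α Y' β S(Z') = 1` -/
  phi_inv_antipode : LinearMap.mul' k H
    (TensorProduct.map (LinearMap.mulRight k alpha ∘ₗ S.toLinearMap)
      (LinearMap.mul' k H ∘ₗ
        TensorProduct.map (LinearMap.mulRight k beta) S.toLinearMap)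
      ((phi⁻¹ : (H ⊗[k] (H ⊗[k] H))ˣ) : H ⊗[k] (H ⊗[k] H))) = 1

/-- A linear functional `ω` on an algebra is nondegenerate if the bilinear form
`(a, b) ↦ ω (a * b)` is nondegenerate. -/
def NondegenerateFunctional {k H : Type*} [Field k] [Ring H] [Algebra k H]
    (ω : H →ₗ[k] k) : Prop :=
  (∀ a : H, (∀ b : H, ω (a * b) = 0) → a = 0) ∧ (∀ a : H, (∀ b : H, ω (b * a) = 0) → a = 0)

theorem exists_mul_of_nondegenerate {k H : Type*} [Field k] [Ring H] [Algebra k H]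
    [FiniteDimensional k H] {ω : H →ₗ[k] k}
    (hω : NondegenerateFunctional ω) (ψ : H →ₗ[k] k) : ∃ u : H, ∀ b : H, ψ b = ω (b * u) := by
  let F : H →ₗ[k] Module.Dual k H := (LinearMap.mul k H).flip.compr₂ ω
  have hinj : Function.Injective F := by
    rw [← LinearMap.ker_eq_bot, LinearMap.ker_eq_bot']
    intro a ha
    exact hω.2 a fun b => by simpa [F] using LinearMap.congr_fun ha b
  have hsurj : Function.Surjective F :=
    (LinearMap.injective_iff_surjective_of_finrank_eq_finrank
      (Subspace.dual_finrank_eq (K := k) (V := H)).symm).1 hinj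
  obtain ⟨u, hu⟩ := hsurj ψ
  exact ⟨u, fun b => by simpa [F] using (LinearMap.congr_fun hu b).symm⟩

/-- `θ` is the modular (Nakayama) automorphism of `ω`. -/
def IsModularAutomorphism {k H : Type*} [Field k] [Ring H] [Algebra k H]
    (ω : H →ₗ[k] k) (θ : H ≃ₐ[k] H) : Prop :=
  ∀ a b : H, ω (a * b) = ω (b * θ a)

/-- An algebra is symmetric if it admits a nondegenerate trace. -/
def IsSymmetricFrobenius (k H : Type*) [Field k] [Ring H] [Algebra k H] : Prop :=
  ∃ τ : H →ₗ[k] k, NondegenerateFunctional τ ∧ ∀ a b : H, τ (a * b) = τ (b * a)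

/-- A map on a ring is an inner automorphism if it is conjugation by a unit. -/
def IsInnerAutomorphism {H : Type*} [Ring H] (f : H → H) : Prop :=
  ∃ g : Hˣ, ∀ x : H, f x = (g : H) * x * ((g⁻¹ : Hˣ) : H)

namespace QuasiHopfAlgebra

section
variable (k : Type*) {H : Type*} [Field k] [Ring H] [Algebra k H] [QuasiHopfAlgebra k H]

/-- Left integrals: `a l = ε(a) l` for all `a`. -/
def IsLeftIntegral (l : H) : Prop :=
  ∀ a : H, a * l = QuasiBialgebra.counit (k := k) a • l

/-- Right integrals: `r a = ε(a) r` for all `a`. -/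
def IsRightIntegral (r : H) : Prop :=
  ∀ a : H, r * a = QuasiBialgebra.counit (k := k) a • r

/-- Invariance under the antipode. -/
def IsSInvariant (l : H) : Prop := S (k := k) l = l
end

section
variable {k H : Type*} [Field k] [Ring H] [Algebra k H] [QuasiHopfAlgebra k H]

/-- `μ` is the modulus of `H`: `μ = ε ∘ θ⁻¹`, with `θ` the modular automorphism of a
nondegenerate functional. In finite dimension it does not depend on that functional, see
`IsModulus.unique`. -/
def IsModulus (μ : H →ₐ[k] k) : Prop :=
  ∃ (ω : H →ₗ[k] k) (θ : H ≃ₐ[k] H), NondegenerateFunctional ω ∧ IsModularAutomorphism ω θ ∧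
    ∀ a : H, μ a = QuasiBialgebra.counit (k := k) (θ.symm a)

/-- The modulus does not depend on the nondegenerate functional used to define it. -/
theorem IsModulus.unique [FiniteDimensional k H] {μ ν : H →ₐ[k] k}
    (hμ : IsModulus μ) (hν : IsModulus ν) : μ = ν := by
  obtain ⟨ω, θ, hω, hθ, hμ⟩ := hμ
  obtain ⟨ω', θ', hω', hθ', hν⟩ := hν
  obtain ⟨u, hu⟩ := exists_mul_of_nondegenerate hω ω'
  obtain ⟨v, hv⟩ := exists_mul_of_nondegenerate hω' ω
  have huv : u * v = 1 := by
    refine sub_eq_zero.1 (hω'.2 _ fun b => ?_)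
    rw [mul_sub, map_sub, mul_one, ← mul_assoc, ← hv, ← hu, sub_self]
  have hvu : v * u = 1 := by
    refine sub_eq_zero.1 (hω.2 _ fun b => ?_)
    rw [mul_sub, map_sub, mul_one, ← mul_assoc, ← hu, ← hv, sub_self]
  have key : ∀ a, θ' a * u = u * θ a := by
    intro a
    refine sub_eq_zero.1 (hω.2 _ fun b => ?_)
    rw [mul_sub, map_sub, ← mul_assoc, ← hu, ← hθ' a b, ← mul_assoc, ← hθ a (b * u),
      ← mul_assoc, ← hu, sub_self]
  ext b
  rw [hμ, hν]
  have h1 : QuasiBialgebra.counit (k := k) (θ.symm u) *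
      QuasiBialgebra.counit (k := k) (θ.symm v) = 1 := by
    rw [← map_mul, ← map_mul, huv, map_one, map_one]
  have h2 := congrArg (fun x => QuasiBialgebra.counit (k := k) (θ.symm x)) (key (θ'.symm b))
  simp only [AlgEquiv.apply_symm_apply, AlgEquiv.symm_apply_apply, map_mul] at h2
  rw [mul_comm] at h2
  exact mul_left_cancel₀ (left_ne_zero_of_mul_eq_one h1) h2

end

/-- `H` is unimodular if its modulus is the counit. -/
def IsUnimodular (k H : Type*) [Field k] [Ring H] [Algebra k H] [QuasiHopfAlgebra k H] : Prop :=
  IsModulus (QuasiBialgebra.counit : H →ₐ[k] k)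

end QuasiHopfAlgebra

/-!
The idea is that an integral gives explicit dual bases for a Frobenius structure on `H`.

Put `q = ∑ X ⊗ S⁻¹(α Z) Y` and `p = ∑ X' ⊗ Y' β S(Z')`, with `φ = ∑ X ⊗ Y ⊗ Z` and
`φ⁻¹ = ∑ X' ⊗ Y' ⊗ Z'`. Quasi-coassociativity gives `∑ (1 ⊗ S⁻¹(a₂)) q Δ(a₁) = (a ⊗ 1) q` and
`∑ Δ(a₁) p (1 ⊗ S(a₂)) = p (a ⊗ 1)` (`qTwist_comul`, `pTwist_comul`), and the pentagon gives
`∑ (1 ⊗ S⁻¹(p₂)) q Δ(p₁) = 1 = ∑ Δ(q₁) p (1 ⊗ S(q₂))` (`qTwist_pElt`, `pTwist_qElt`).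

* Nonzero integrals exist (`exists_isLeftIntegral`): `q` and `p` identify the diagonal `H`-module
  `H ⊗ H*` with a free module, and the diagonal module contains the nonzero invariant
  `∑ β eᵢ ⊗ eⁱ`.
* Let `l ≠ 0` be a two-sided integral and `E = q Δ(l) p`. Then `(a ⊗ 1) E = (1 ⊗ S⁻¹(a)) E` and
  `E (a ⊗ 1) = E (1 ⊗ S(a))`, so the elements `f(E₁) E₂`, for `f` in `H*`, form a two-sided ideal.
  It is also a left coideal, and the antipode axioms force it to contain `1`
  (`exists_slice_frobeniusElt_eq_one`). A functional `ω` with `ω(E₁) E₂ = 1` is nondegenerate with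
  modular automorphism `S⁻²` (`exists_nondegenerate_of_two_sided`), so `H` is unimodular.
  Moreover `ω(a E₁) E₂ = S⁻¹(a)` and `E₁ ε(E₂) = l = ε(E₁) E₂`; evaluating at `a = S(l)` shows that
  `S(l) = c l` is possible only for `c = 1` (`eq_one_of_S_eq_smul`).
* If `H` is unimodular, left and right integrals form the same line
  (`IsUnimodular.exists_integral`), so `S` acts on it by a scalar, which is `1`. Conversely an
  `S`-invariant left or right integral is two-sided, since `S` exchanges left and right integrals.
* For symmetry, compare a nondegenerate trace with the functional `ω` above: two nondegenerate
  functionals differ by a unit, and their modular automorphisms by conjugation with it.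
-/

namespace QuasiHopfAlgebra

open QuasiBialgebra TensorProduct

/-! ### Iterated tensor powers -/

section
variable {k H : Type*} [Field k] [Ring H] [Algebra k H]

-- Solving the pentagon for a product with an outer factor. The tensor factors are visible because
-- instances on iterated tensor powers fail to unify with those of a general monoid.

theorem mul_eq_of_mul_eq_mul_mul {A B : Type*} [Ring A] [Algebra k A] [Ring B]
    [Algebra k B] {a b c d f b' c' d' : A ⊗[k] B}
    (h : a * b = c * d * f) (hd : d' * d = 1) (hc : c' * c = 1) (hb : b * b' = 1) :
    f * b' = d' * c' * a := by
  have hf : f = d' * c' * (a * b) := by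
    rw [h, mul_assoc d', mul_assoc c, ← mul_assoc c', hc, one_mul, ← mul_assoc, hd, one_mul]
  rw [hf, mul_assoc, mul_assoc a, hb, mul_one]

theorem mul_eq_of_mul_eq_mul_mul' {A B : Type*} [Ring A] [Algebra k A] [Ring B]
    [Algebra k B] {a b c d f a' f' : A ⊗[k] B}
    (h : a * b = c * d * f) (ha : a' * a = 1) (hf : f * f' = 1) :
    b * f' = a' * (c * d) := by
  have hb : b = a' * (c * d * f) := by rw [← h, ← mul_assoc, ha, one_mul]
  rw [hb, mul_assoc, mul_assoc (c * d), hf, mul_one]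

section
variable {A B : Type*} [Ring A] [Algebra k A] [Ring B] [Algebra k B]

-- Restatements of the ring axioms with visible tensor factors: on iterated tensor powers the
-- general lemmas fail to unify.

theorem tensor_mul_zero (x : A ⊗[k] B) : x * 0 = 0 := mul_zero x

theorem tensor_zero_mul (x : A ⊗[k] B) : 0 * x = 0 := zero_mul x

theorem tensor_mul_add (x y z : A ⊗[k] B) : x * (y + z) = x * y + x * z := mul_add x y z

theorem tensor_add_mul (x y z : A ⊗[k] B) : (x + y) * z = x * z + y * z := add_mul x y z

theorem tensor_mul_assoc (x y z : A ⊗[k] B) : x * y * z = x * (y * z) := mul_assoc x y z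

end

theorem threefold_induction {p : H ⊗[k] (H ⊗[k] H) → Prop} (zero : p 0)
    (tmul : ∀ a b c : H, p (a ⊗ₜ (b ⊗ₜ c))) (add : ∀ s t, p s → p t → p (s + t))
    (t : H ⊗[k] (H ⊗[k] H)) : p t := by
  induction t using TensorProduct.induction_on with
  | zero => exact zero
  | add s t hs ht => exact add s t hs ht
  | tmul a w =>
    induction w using TensorProduct.induction_on with
    | zero => simpa using zero
    | add s t hs ht => simpa only [tmul_add] using add _ _ hs ht
    | tmul b c => exact tmul a b c

variable (k H) in
/-- `t ↦ t ⊗ 1`, rebracketed to the right like the fourfold tensor power in `pentagon`. -/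
noncomputable def tmulOne : H ⊗[k] (H ⊗[k] H) →ₐ[k] H ⊗[k] (H ⊗[k] (H ⊗[k] H)) :=
  (Algebra.TensorProduct.map (AlgHom.id k H)
    (Algebra.TensorProduct.assoc k k k H H H).toAlgHom).comp
    ((Algebra.TensorProduct.assoc k k k H (H ⊗[k] H) H).toAlgHom.comp
      Algebra.TensorProduct.includeLeft)

@[simp] theorem tmulOne_tmul (a b c : H) :
    tmulOne k H (a ⊗ₜ (b ⊗ₜ c)) = a ⊗ₜ (b ⊗ₜ (c ⊗ₜ 1)) := rfl

end

section
variable {k H : Type*} [Field k] [Ring H] [Algebra k H] [QuasiHopfAlgebra k H]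

local notation "Δ" => (QuasiBialgebra.comul : H →ₐ[k] H ⊗[k] H)
local notation "ε" => (QuasiBialgebra.counit : H →ₐ[k] k)
local notation "σ" => (QuasiHopfAlgebra.S : H ≃ₗ[k] H)
local notation "α" => (QuasiHopfAlgebra.alpha k : H)
local notation "β" => (QuasiHopfAlgebra.beta k : H)
local notation "Φ" => ((QuasiBialgebra.phi : (H ⊗[k] (H ⊗[k] H))ˣ) : H ⊗[k] (H ⊗[k] H))
local notation "Φi" => Units.val (QuasiBialgebra.phi⁻¹ : (H ⊗[k] (H ⊗[k] H))ˣ)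

/-! ### Contractions by the antipode, and its compatibility with the counit -/

theorem S_symm_mul (a b : H) : (σ).symm (a * b) = (σ).symm b * (σ).symm a :=
  (σ).injective (by simp [S_mul])

variable (k H) in
/-- The contraction `x ⊗ y ↦ S(x) α y`. -/
noncomputable def contractAlpha : H ⊗[k] H →ₗ[k] H :=
  LinearMap.mul' k H ∘ₗ
    TensorProduct.map (LinearMap.mulRight k α ∘ₗ (σ).toLinearMap) LinearMap.id

variable (k H) in
/-- The contraction `x ⊗ y ↦ x β S(y)`. -/
noncomputable def contractBeta : H ⊗[k] H →ₗ[k] H :=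
  LinearMap.mul' k H ∘ₗ TensorProduct.map (LinearMap.mulRight k β) (σ).toLinearMap

variable (k H) in
/-- The contraction `x ⊗ y ⊗ z ↦ S(x) α y β S(z)`. -/
noncomputable def contractAlphaBeta : H ⊗[k] (H ⊗[k] H) →ₗ[k] H :=
  LinearMap.mul' k H ∘ₗ
    TensorProduct.map (LinearMap.mulRight k α ∘ₗ (σ).toLinearMap) (contractBeta k H)

variable (k H) in
/-- The contraction `x ⊗ y ⊗ z ↦ x β S(y) α z`. -/
noncomputable def contractBetaAlpha : H ⊗[k] (H ⊗[k] H) →ₗ[k] H :=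
  LinearMap.mul' k H ∘ₗ TensorProduct.map (LinearMap.mulRight k β) (contractAlpha k H)

@[simp] theorem contractAlpha_tmul (x y : H) : contractAlpha k H (x ⊗ₜ y) = σ x * α * y := rfl

@[simp] theorem contractBeta_tmul (x y : H) : contractBeta k H (x ⊗ₜ y) = x * β * σ y := rfl

@[simp] theorem contractAlphaBeta_tmul (x : H) (t : H ⊗[k] H) :
    contractAlphaBeta k H (x ⊗ₜ t) = σ x * α * contractBeta k H t := rfl

@[simp] theorem contractBetaAlpha_tmul (x : H) (t : H ⊗[k] H) :
    contractBetaAlpha k H (x ⊗ₜ t) = x * β * contractAlpha k H t := rfl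

theorem contractAlpha_comul (a : H) : contractAlpha k H (Δ a) = ε a • α := S_alpha a

theorem contractBeta_comul (a : H) : contractBeta k H (Δ a) = ε a • β := beta_S a

theorem contractAlphaBeta_phi_inv : contractAlphaBeta k H Φi = 1 := phi_inv_antipode

theorem contractBetaAlpha_phi : contractBetaAlpha k H Φ = 1 := phi_antipode

theorem contractAlpha_mul_tmul (w : H ⊗[k] H) (b c : H) :
    contractAlpha k H (w * b ⊗ₜ c) = σ b * contractAlpha k H w * c := by
  induction w using TensorProduct.induction_on with
  | zero => simp
  | tmul x y => simp [S_mul, mul_assoc]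
  | add x y hx hy => simp only [add_mul, mul_add, map_add, hx, hy]

theorem contractBeta_tmul_mul (w : H ⊗[k] H) (b c : H) :
    contractBeta k H (b ⊗ₜ c * w) = b * contractBeta k H w * σ c := by
  induction w using TensorProduct.induction_on with
  | zero => simp
  | tmul x y => simp [S_mul, mul_assoc]
  | add x y hx hy => simp only [add_mul, mul_add, map_add, hx, hy]

variable (k H) in
/-- `id ⊗ ε ⊗ id`. -/
noncomputable def counitMiddle : H ⊗[k] (H ⊗[k] H) →ₐ[k] H ⊗[k] H :=
  Algebra.TensorProduct.map (AlgHom.id k H)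
    ((Algebra.TensorProduct.lid k H).toAlgHom.comp
      (Algebra.TensorProduct.map ε (AlgHom.id k H)))

variable (k H) in
/-- `id ⊗ id ⊗ ε`. -/
noncomputable def counitRight : H ⊗[k] (H ⊗[k] H) →ₐ[k] H ⊗[k] H :=
  Algebra.TensorProduct.map (AlgHom.id k H)
    ((Algebra.TensorProduct.rid k k H).toAlgHom.comp
      (Algebra.TensorProduct.map (AlgHom.id k H) ε))

@[simp] theorem counitMiddle_tmul (a b c : H) :
    counitMiddle k H (a ⊗ₜ (b ⊗ₜ c)) = ε b • (a ⊗ₜ c) := by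
  simp [counitMiddle]

@[simp] theorem counitRight_tmul (a b c : H) :
    counitRight k H (a ⊗ₜ (b ⊗ₜ c)) = ε c • (a ⊗ₜ b) := by
  simp [counitRight]

theorem counitMiddle_phi : counitMiddle k H Φ = 1 := counit_phi

theorem counitMiddle_phi_inv : counitMiddle k H Φi = 1 := by
  have h : counitMiddle k H (Φ * Φi) = 1 := by simp
  rwa [map_mul, counitMiddle_phi, one_mul] at h

theorem counit_alpha_mul_counit_S (a : H) : ε α * ε (σ a) = ε α * ε a := by
  have key : ∀ w : H ⊗[k] H, ε (contractAlpha k H w) =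
      ε α * ε (σ (Algebra.TensorProduct.rid k k H
        (Algebra.TensorProduct.map (AlgHom.id k H) ε w))) := by
    intro w
    induction w using TensorProduct.induction_on with
    | zero => simp
    | tmul x y => simp; ring
    | add x y hx hy => simp only [map_add, mul_add, hx, hy]
  have h := key (Δ a)
  rw [comul_counit, contractAlpha_comul, map_smul, smul_eq_mul] at h
  rw [← h, mul_comm]

theorem counit_alpha_mul_counit_beta : ε α * ε β = 1 := by
  have key : ∀ t : H ⊗[k] (H ⊗[k] H), ε (contractBetaAlpha k H t) =
      ε α * ε β * ε (LinearMap.mul' k H (counitMiddle k H t)) := by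
    intro t
    induction t using threefold_induction with
    | zero => simp
    | tmul a b c =>
      simp only [contractBetaAlpha_tmul, contractAlpha_tmul, map_mul, counitMiddle_tmul, map_smul,
        LinearMap.mul'_apply, smul_eq_mul]
      linear_combination (ε a * ε β * ε c) * counit_alpha_mul_counit_S (k := k) b
    | add s t hs ht => simp only [map_add, mul_add, hs, ht]
  have h := key Φ
  rw [contractBetaAlpha_phi, counitMiddle_phi, Algebra.TensorProduct.one_def] at h
  simpa using h.symm

theorem counit_alpha_ne_zero : ε α ≠ 0 := left_ne_zero_of_mul_eq_one counit_alpha_mul_counit_beta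

theorem counit_S (a : H) : ε (σ a) = ε a :=
  mul_left_cancel₀ counit_alpha_ne_zero (counit_alpha_mul_counit_S a)

theorem counit_S_symm (a : H) : ε ((σ).symm a) = ε a := by
  rw [← counit_S, LinearEquiv.apply_symm_apply]

/-! ### The pentagon and the counits of the reassociator -/

variable (k H) in
/-- `id ⊗ id ⊗ Δ`. -/
noncomputable def comulRight : H ⊗[k] (H ⊗[k] H) →ₐ[k] H ⊗[k] (H ⊗[k] (H ⊗[k] H)) :=
  Algebra.TensorProduct.map (AlgHom.id k H) (Algebra.TensorProduct.map (AlgHom.id k H) Δ)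

variable (k H) in
/-- `Δ ⊗ id ⊗ id`. -/
noncomputable def comulLeft : H ⊗[k] (H ⊗[k] H) →ₐ[k] H ⊗[k] (H ⊗[k] (H ⊗[k] H)) :=
  (Algebra.TensorProduct.assoc k k k H H (H ⊗[k] H)).toAlgHom.comp
    (Algebra.TensorProduct.map Δ (AlgHom.id k (H ⊗[k] H)))

variable (k H) in
/-- `id ⊗ Δ ⊗ id`. -/
noncomputable def comulMiddle : H ⊗[k] (H ⊗[k] H) →ₐ[k] H ⊗[k] (H ⊗[k] (H ⊗[k] H)) :=
  Algebra.TensorProduct.map (AlgHom.id k H)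
    ((Algebra.TensorProduct.assoc k k k H H H).toAlgHom.comp
      (Algebra.TensorProduct.map Δ (AlgHom.id k H)))

@[simp] theorem comulRight_tmul (a b c : H) :
    comulRight k H (a ⊗ₜ (b ⊗ₜ c)) = a ⊗ₜ (b ⊗ₜ Δ c) := rfl

@[simp] theorem comulLeft_tmul (a : H) (t : H ⊗[k] H) :
    comulLeft k H (a ⊗ₜ t) = Algebra.TensorProduct.assoc k k k H H (H ⊗[k] H) (Δ a ⊗ₜ t) := rfl

@[simp] theorem comulMiddle_tmul (a b c : H) :
    comulMiddle k H (a ⊗ₜ (b ⊗ₜ c)) =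
      a ⊗ₜ Algebra.TensorProduct.assoc k k k H H H (Δ b ⊗ₜ c) := rfl

theorem pentagon_phi : comulRight k H Φ * comulLeft k H Φ =
    1 ⊗ₜ Φ * comulMiddle k H Φ * tmulOne k H Φ := pentagon

theorem map_phi_mul_map_phi_inv {B : Type*} [Semiring B] [Algebra k B]
    (f : H ⊗[k] (H ⊗[k] H) →ₐ[k] B) : f Φ * f Φi = 1 := by
  rw [← map_mul, Units.mul_inv, map_one]

theorem map_phi_inv_mul_map_phi {B : Type*} [Semiring B] [Algebra k B]
    (f : H ⊗[k] (H ⊗[k] H) →ₐ[k] B) : f Φi * f Φ = 1 := by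
  rw [← map_mul, Units.inv_mul, map_one]

theorem tmul_phi_inv_mul_tmul_phi : (1 : H) ⊗ₜ[k] Φi * 1 ⊗ₜ[k] Φ = 1 := by
  simp [Algebra.TensorProduct.one_def]

theorem tmulOne_phi_mul_comulLeft_phi_inv : tmulOne k H Φ * comulLeft k H Φi =
    comulMiddle k H Φi * 1 ⊗ₜ Φi * comulRight k H Φ :=
  mul_eq_of_mul_eq_mul_mul pentagon_phi (map_phi_inv_mul_map_phi _)
    (tmul_phi_inv_mul_tmul_phi) (map_phi_mul_map_phi_inv _)

theorem comulLeft_phi_mul_tmulOne_phi_inv : comulLeft k H Φ * tmulOne k H Φi =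
    comulRight k H Φi * (1 ⊗ₜ Φ * comulMiddle k H Φ) :=
  mul_eq_of_mul_eq_mul_mul' pentagon_phi (map_phi_inv_mul_map_phi _) (map_phi_mul_map_phi_inv _)

/-- Applying `ε` to the third leg of the pentagon gives `(id ⊗ id ⊗ ε)(φ) = 1`. -/
theorem counitRight_phi : counitRight k H Φ = 1 := by
  let e : H ⊗[k] (H ⊗[k] (H ⊗[k] H)) →ₐ[k] H ⊗[k] (H ⊗[k] H) :=
    Algebra.TensorProduct.map (AlgHom.id k H) (counitMiddle k H)
  have he : ∀ (a : H) (t : H ⊗[k] (H ⊗[k] H)), e (a ⊗ₜ t) = a ⊗ₜ counitMiddle k H t :=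
    fun a t => rfl
  have hR : ∀ t, e (comulRight k H t) = t := by
    intro t
    induction t using threefold_induction with
    | zero => simp
    | add s t hs ht => simp only [map_add, hs, ht]
    | tmul a b c =>
      have key : ∀ w : H ⊗[k] H, counitMiddle k H (b ⊗ₜ w) = b ⊗ₜ (Algebra.TensorProduct.lid k H
          (Algebra.TensorProduct.map ε (AlgHom.id k H) w)) := fun w => rfl
      rw [comulRight_tmul, he, key, counit_comul]
  have hL : ∀ t, e (comulLeft k H t) = Algebra.TensorProduct.assoc k k k H H H
      (Algebra.TensorProduct.map Δ (AlgHom.id k H) (counitMiddle k H t)) := by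
    intro t
    induction t using threefold_induction with
    | zero => simp
    | add s t hs ht => simp only [map_add, hs, ht]
    | tmul a b c =>
      have key : ∀ w : H ⊗[k] H, e (Algebra.TensorProduct.assoc k k k H H (H ⊗[k] H)
          (w ⊗ₜ (b ⊗ₜ c))) = ε b • Algebra.TensorProduct.assoc k k k H H H (w ⊗ₜ c) := by
        intro w
        induction w using TensorProduct.induction_on with
        | zero => simp
        | tmul x y => simp [he]
        | add x y hx hy => simp only [add_tmul, map_add, smul_add, hx, hy]
      rw [comulLeft_tmul, key]
      simp
  have hM : ∀ t, e (comulMiddle k H t) = t := by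
    intro t
    induction t using threefold_induction with
    | zero => simp
    | add s t hs ht => simp only [map_add, hs, ht]
    | tmul a b c =>
      have key : ∀ w : H ⊗[k] H, counitMiddle k H (Algebra.TensorProduct.assoc k k k H H H
          (w ⊗ₜ c)) = (Algebra.TensorProduct.rid k k H
          (Algebra.TensorProduct.map (AlgHom.id k H) ε w)) ⊗ₜ c := by
        intro w
        induction w using TensorProduct.induction_on with
        | zero => simp
        | tmul x y => simp [smul_tmul']
        | add x y hx hy => simp only [add_tmul, map_add, hx, hy]
      rw [comulMiddle_tmul, he, key, comul_counit]
  have hO : ∀ t, counitRight k H (e (tmulOne k H t)) = counitRight k H t := by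
    intro t
    induction t using threefold_induction with
    | zero => simp
    | add s t hs ht => simp only [map_add, hs, ht]
    | tmul a b c => simp [he]
  have h := congrArg e (pentagon_phi (k := k) (H := H))
  rw [map_mul, map_mul, map_mul, hR, hL, hM, he, counitMiddle_phi, map_one, map_one, mul_one,
    ← Algebra.TensorProduct.one_def, one_mul] at h
  have h1 : e (tmulOne k H Φ) = 1 := by
    have h2 := congrArg (fun x => Φi * x) h
    simpa using h2.symm
  rw [← hO, h1, map_one]

theorem counitRight_phi_inv : counitRight k H Φi = 1 := by
  have h : counitRight k H (Φ * Φi) = 1 := by simp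
  rwa [map_mul, counitRight_phi, one_mul] at h

/-! ### The elements q and p -/

variable (k H) in
/-- The linear map `x ⊗ y ⊗ z ↦ x ⊗ S⁻¹(α z) y`. -/
noncomputable def qMap : H ⊗[k] (H ⊗[k] H) →ₗ[k] H ⊗[k] H :=
  TensorProduct.map LinearMap.id ((σ).symm.toLinearMap ∘ₗ contractAlpha k H)

variable (k H) in
/-- The linear map `x ⊗ y ⊗ z ↦ x ⊗ y β S(z)`. -/
noncomputable def pMap : H ⊗[k] (H ⊗[k] H) →ₗ[k] H ⊗[k] H :=
  TensorProduct.map LinearMap.id (contractBeta k H)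

variable (k H) in
/-- The element `q = ∑ X ⊗ S⁻¹(α Z) Y`, where `φ = ∑ X ⊗ Y ⊗ Z`. -/
noncomputable def qElt : H ⊗[k] H := qMap k H Φ

variable (k H) in
/-- The element `p = ∑ X' ⊗ Y' β S(Z')`, where `φ⁻¹ = ∑ X' ⊗ Y' ⊗ Z'`. -/
noncomputable def pElt : H ⊗[k] H := pMap k H Φi

@[simp] theorem qMap_tmul (a : H) (w : H ⊗[k] H) :
    qMap k H (a ⊗ₜ w) = a ⊗ₜ (σ).symm (contractAlpha k H w) := rfl

@[simp] theorem pMap_tmul (a : H) (w : H ⊗[k] H) :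
    pMap k H (a ⊗ₜ w) = a ⊗ₜ contractBeta k H w := rfl

variable (k H) in
/-- The linear map `x ⊗ y ↦ (1 ⊗ S⁻¹(y)) q Δ(x)`. -/
noncomputable def qTwist : H ⊗[k] H →ₗ[k] H ⊗[k] H :=
  TensorProduct.lift (LinearMap.mk₂ k (fun x y => (1 ⊗ₜ (σ).symm y) * qElt k H * Δ x)
    (fun x x' y => by simp [mul_add]) (fun c x y => by simp)
    (fun x y y' => by simp [tmul_add, add_mul]) (fun c x y => by simp))

variable (k H) in
/-- The linear map `x ⊗ y ↦ Δ(x) p (1 ⊗ S(y))`. -/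
noncomputable def pTwist : H ⊗[k] H →ₗ[k] H ⊗[k] H :=
  TensorProduct.lift (LinearMap.mk₂ k (fun x y => Δ x * pElt k H * (1 ⊗ₜ σ y))
    (fun x x' y => by simp [add_mul]) (fun c x y => by simp)
    (fun x y y' => by simp [tmul_add, mul_add]) (fun c x y => by simp))

@[simp] theorem qTwist_tmul (x y : H) :
    qTwist k H (x ⊗ₜ y) = (1 ⊗ₜ (σ).symm y) * qElt k H * Δ x := rfl

@[simp] theorem pTwist_tmul (x y : H) :
    pTwist k H (x ⊗ₜ y) = Δ x * pElt k H * (1 ⊗ₜ σ y) := rfl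

theorem qMap_mul_assoc (t : H ⊗[k] (H ⊗[k] H)) (u : H ⊗[k] H) (y : H) :
    qMap k H (t * Algebra.TensorProduct.assoc k k k H H H (u ⊗ₜ y)) =
      (1 ⊗ₜ (σ).symm y) * qMap k H t * u := by
  induction t using threefold_induction with
  | zero => simp
  | add s t hs ht => simp only [map_add, add_mul, mul_add, hs, ht]
  | tmul a b c =>
    induction u using TensorProduct.induction_on with
    | zero => simp
    | add u v hu hv => simp only [map_add, add_tmul, mul_add, hu, hv]
    | tmul v w =>
      simp [S_symm_mul, S_mul, mul_assoc]

theorem pMap_assoc_mul (t : H ⊗[k] (H ⊗[k] H)) (u : H ⊗[k] H) (y : H) :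
    pMap k H (Algebra.TensorProduct.assoc k k k H H H (u ⊗ₜ y) * t) =
      u * pMap k H t * (1 ⊗ₜ σ y) := by
  induction t using threefold_induction with
  | zero => simp
  | add s t hs ht => simp only [map_add, add_mul, mul_add, hs, ht]
  | tmul a b c =>
    induction u using TensorProduct.induction_on with
    | zero => simp
    | add u v hu hv => simp only [map_add, add_tmul, add_mul, hu, hv]
    | tmul v w => simp [S_mul, mul_assoc]

theorem qMap_comul_mul (u : H ⊗[k] H) (t : H ⊗[k] (H ⊗[k] H)) :
    qMap k H (Algebra.TensorProduct.map (AlgHom.id k H) Δ u * t) =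
      (Algebra.TensorProduct.rid k k H (Algebra.TensorProduct.map (AlgHom.id k H) ε u)) ⊗ₜ 1 *
        qMap k H t := by
  induction u using TensorProduct.induction_on with
  | zero => simp
  | add u v hu hv => simp only [map_add, add_tmul, add_mul, hu, hv]
  | tmul x y =>
    induction t using threefold_induction with
    | zero => simp
    | add s t hs ht => simp only [map_add, mul_add, hs, ht]
    | tmul a b c =>
      simp [contractAlpha_mul_tmul, contractAlpha_comul, smul_tmul']

theorem pMap_mul_comul (u : H ⊗[k] H) (t : H ⊗[k] (H ⊗[k] H)) :
    pMap k H (t * Algebra.TensorProduct.map (AlgHom.id k H) Δ u) =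
      pMap k H t * (Algebra.TensorProduct.rid k k H
        (Algebra.TensorProduct.map (AlgHom.id k H) ε u)) ⊗ₜ 1 := by
  induction u using TensorProduct.induction_on with
  | zero => simp
  | add u v hu hv => simp only [map_add, add_tmul, mul_add, hu, hv]
  | tmul x y =>
    induction t using threefold_induction with
    | zero => simp
    | add s t hs ht => simp only [map_add, add_mul, hs, ht]
    | tmul a b c =>
      simp [contractBeta_tmul_mul, contractBeta_comul, smul_tmul']

/-- `∑ (1 ⊗ S⁻¹(a₂)) q Δ(a₁) = (a ⊗ 1) q`. -/
theorem qTwist_comul (a : H) : qTwist k H (Δ a) = (a ⊗ₜ 1) * qElt k H := by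
  have key : ∀ u : H ⊗[k] H, qTwist k H u = qMap k H (Φ * Algebra.TensorProduct.assoc k k k H H H
      (Algebra.TensorProduct.map Δ (AlgHom.id k H) u)) := by
    intro u
    induction u using TensorProduct.induction_on with
    | zero => simp
    | add u v hu hv => simp only [map_add, mul_add, hu, hv]
    | tmul x y =>
      rw [Algebra.TensorProduct.map_tmul, AlgHom.id_apply, qMap_mul_assoc, qTwist_tmul, qElt]
  rw [key, ← quasi_coassoc, qMap_comul_mul, comul_counit, qElt]

theorem comul_assoc_mul_phi_inv (a : H) : Algebra.TensorProduct.assoc k k k H H H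
      (Algebra.TensorProduct.map Δ (AlgHom.id k H) (Δ a)) * Φi =
    Φi * Algebra.TensorProduct.map (AlgHom.id k H) Δ (Δ a) := by
  have h := congrArg (fun x => Φi * x * Φi) (quasi_coassoc (k := k) a)
  simpa [mul_assoc] using h.symm

/-- `∑ Δ(a₁) p (1 ⊗ S(a₂)) = p (a ⊗ 1)`. -/
theorem pTwist_comul (a : H) : pTwist k H (Δ a) = pElt k H * (a ⊗ₜ 1) := by
  have key : ∀ u : H ⊗[k] H, pTwist k H u = pMap k H (Algebra.TensorProduct.assoc k k k H H H
      (Algebra.TensorProduct.map Δ (AlgHom.id k H) u) * Φi) := by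
    intro u
    induction u using TensorProduct.induction_on with
    | zero => simp
    | add u v hu hv => simp only [map_add, add_mul, hu, hv]
    | tmul x y =>
      rw [Algebra.TensorProduct.map_tmul, AlgHom.id_apply, pMap_assoc_mul, pTwist_tmul, pElt]
  rw [key, comul_assoc_mul_phi_inv, pMap_mul_comul, comul_counit, pElt]

theorem contractAlphaBeta_assoc_mul (b c : H) (t : H ⊗[k] (H ⊗[k] H)) :
    contractAlphaBeta k H (Algebra.TensorProduct.assoc k k k H H H (Δ b ⊗ₜ c) * t) =
      ε b • (contractAlphaBeta k H t * σ c) := by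
  have key : ∀ (w : H ⊗[k] H) (x y z : H),
      contractAlphaBeta k H (Algebra.TensorProduct.assoc k k k H H H (w ⊗ₜ c) * x ⊗ₜ (y ⊗ₜ z)) =
        σ x * contractAlpha k H w * y * β * σ z * σ c := by
    intro w x y z
    induction w using TensorProduct.induction_on with
    | zero => simp
    | add u v hu hv => simp only [map_add, add_tmul, add_mul, mul_add, hu, hv]
    | tmul v w => simp [S_mul, mul_assoc]
  induction t using threefold_induction with
  | zero => simp
  | add s t hs ht => simp only [map_add, mul_add, add_mul, smul_add, hs, ht]
  | tmul x y z => simp [key, contractAlpha_comul, mul_assoc]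

theorem contractAlphaBeta_mul_tmul_comul (y z : H) (t : H ⊗[k] (H ⊗[k] H)) :
    contractAlphaBeta k H (t * y ⊗ₜ Δ z) = ε z • (σ y * contractAlphaBeta k H t) := by
  induction t using threefold_induction with
  | zero => simp
  | add s t hs ht => simp only [map_add, mul_add, add_mul, smul_add, hs, ht]
  | tmul a b c => simp [contractBeta_tmul_mul, contractBeta_comul, S_mul, mul_assoc]

theorem contractBetaAlpha_tmul_comul_mul (y z : H) (t : H ⊗[k] (H ⊗[k] H)) :
    contractBetaAlpha k H (y ⊗ₜ Δ z * t) = ε z • (y * contractBetaAlpha k H t) := by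
  induction t using threefold_induction with
  | zero => simp
  | add s t hs ht => simp only [map_add, mul_add, smul_add, hs, ht]
  | tmul a b c => simp [contractAlpha_mul_tmul, contractAlpha_comul, mul_assoc]

theorem contractBetaAlpha_mul_assoc (b c : H) (t : H ⊗[k] (H ⊗[k] H)) :
    contractBetaAlpha k H (t * Algebra.TensorProduct.assoc k k k H H H (Δ b ⊗ₜ c)) =
      ε b • (contractBetaAlpha k H t * c) := by
  have key : ∀ (w : H ⊗[k] H) (x y z : H),
      contractBetaAlpha k H (x ⊗ₜ (y ⊗ₜ z) * Algebra.TensorProduct.assoc k k k H H H (w ⊗ₜ c)) =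
        x * contractBeta k H w * σ y * α * z * c := by
    intro w x y z
    induction w using TensorProduct.induction_on with
    | zero => simp
    | add u v hu hv => simp only [map_add, add_tmul, add_mul, mul_add, hu, hv]
    | tmul v w => simp [S_mul, mul_assoc]
  induction t using threefold_induction with
  | zero => simp
  | add s t hs ht => simp only [map_add, add_mul, smul_add, hs, ht]
  | tmul x y z => simp [key, contractBeta_comul, mul_assoc]

/-- `∑ (1 ⊗ S⁻¹(p₂)) q Δ(p₁) = 1 ⊗ 1`: contract the pentagon, solved for
`(φ ⊗ 1) (Δ ⊗ id ⊗ id)(φ⁻¹)`, by `id ⊗ (x ⊗ y ⊗ z ↦ S(x) α y β S(z))`. -/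
theorem qTwist_pElt : qTwist k H (pElt k H) = 1 := by
  have hS : Function.Injective (TensorProduct.map (LinearMap.id : H →ₗ[k] H) (σ).toLinearMap) :=
    (TensorProduct.congr (LinearEquiv.refl k H) σ).injective
  have hlhs : ∀ t : H ⊗[k] (H ⊗[k] H), TensorProduct.map LinearMap.id (σ).toLinearMap
      (qTwist k H (pMap k H t)) = TensorProduct.map LinearMap.id (contractAlphaBeta k H)
        (tmulOne k H Φ * comulLeft k H t) := by
    have key : ∀ (s : H ⊗[k] (H ⊗[k] H)) (u : H ⊗[k] H) (b c : H),
        TensorProduct.map LinearMap.id (σ).toLinearMap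
          ((1 ⊗ₜ (σ).symm (b * β * σ c)) * qMap k H s * u) =
        TensorProduct.map LinearMap.id (contractAlphaBeta k H)
          (tmulOne k H s * Algebra.TensorProduct.assoc k k k H H (H ⊗[k] H) (u ⊗ₜ (b ⊗ₜ c))) := by
      intro s u b c
      induction s using threefold_induction with
      | zero => simp [tensor_zero_mul]
      | add s t hs ht => simp only [map_add, mul_add, add_mul, tensor_add_mul, hs, ht]
      | tmul x y z =>
        induction u using TensorProduct.induction_on with
        | zero => simp [tensor_mul_zero]
        | add u v hu hv => simp only [map_add, add_tmul, mul_add, tensor_mul_add, hu, hv]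
        | tmul v w => simp [S_mul, mul_assoc]
    intro t
    induction t using threefold_induction with
    | zero => simp [tensor_mul_zero]
    | add s t hs ht => simp only [map_add, tensor_mul_add, hs, ht]
    | tmul a b c =>
      rw [pMap_tmul, contractBeta_tmul, qTwist_tmul, qElt, key, comulLeft_tmul]
  have hrhs : ∀ s r : H ⊗[k] (H ⊗[k] H), TensorProduct.map LinearMap.id (contractAlphaBeta k H)
      (comulMiddle k H s * 1 ⊗ₜ Φi * comulRight k H r) =
      TensorProduct.map LinearMap.id (σ).toLinearMap
        (counitMiddle k H s * counitRight k H r) := by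
    intro s r
    induction s using threefold_induction with
    | zero => simp [tensor_zero_mul]
    | add s t hs ht => simp only [map_add, add_mul, tensor_add_mul, hs, ht]
    | tmul a b c =>
      induction r using threefold_induction with
      | zero => simp [tensor_mul_zero]
      | add s t hs ht => simp only [map_add, mul_add, tensor_mul_add, hs, ht]
      | tmul x y z =>
        simp [contractAlphaBeta_mul_tmul_comul, contractAlphaBeta_assoc_mul,
          contractAlphaBeta_phi_inv, S_mul, smul_smul, mul_comm]
  apply hS
  rw [pElt, hlhs, tmulOne_phi_mul_comulLeft_phi_inv, hrhs, counitMiddle_phi_inv, counitRight_phi]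
  simp [Algebra.TensorProduct.one_def, S_one]

/-- `∑ Δ(q₁) p (1 ⊗ S(q₂)) = 1 ⊗ 1`: contract the pentagon, solved for
`(Δ ⊗ id ⊗ id)(φ) (φ⁻¹ ⊗ 1)`, by `id ⊗ (x ⊗ y ⊗ z ↦ x β S(y) α z)`. -/
theorem pTwist_qElt : pTwist k H (qElt k H) = 1 := by
  have hlhs : ∀ t : H ⊗[k] (H ⊗[k] H), pTwist k H (qMap k H t) =
      TensorProduct.map LinearMap.id (contractBetaAlpha k H)
        (comulLeft k H t * tmulOne k H Φi) := by
    have key : ∀ (s : H ⊗[k] (H ⊗[k] H)) (u : H ⊗[k] H) (b c : H),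
        u * pMap k H s * (1 ⊗ₜ (σ b * α * c)) =
        TensorProduct.map LinearMap.id (contractBetaAlpha k H)
          (Algebra.TensorProduct.assoc k k k H H (H ⊗[k] H) (u ⊗ₜ (b ⊗ₜ c)) * tmulOne k H s) := by
      intro s u b c
      induction s using threefold_induction with
      | zero => simp
      | add s t hs ht => simp only [map_add, mul_add, add_mul, hs, ht]
      | tmul x y z =>
        induction u using TensorProduct.induction_on with
        | zero => simp
        | add u v hu hv => simp only [map_add, add_tmul, add_mul, hu, hv]
        | tmul v w => simp [S_mul, mul_assoc]
    intro t
    induction t using threefold_induction with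
    | zero => simp [tensor_zero_mul]
    | add s t hs ht => simp only [map_add, tensor_add_mul, hs, ht]
    | tmul a b c =>
      rw [qMap_tmul, contractAlpha_tmul, pTwist_tmul, LinearEquiv.apply_symm_apply, pElt, key,
        comulLeft_tmul]
  have hrhs : ∀ s r : H ⊗[k] (H ⊗[k] H), TensorProduct.map LinearMap.id (contractBetaAlpha k H)
      (comulRight k H r * (1 ⊗ₜ Φ * comulMiddle k H s)) =
        counitRight k H r * counitMiddle k H s := by
    intro s r
    induction s using threefold_induction with
    | zero => simp [tensor_mul_zero]
    | add s t hs ht => simp only [map_add, mul_add, tensor_mul_add, hs, ht]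
    | tmul a b c =>
      induction r using threefold_induction with
      | zero => simp [tensor_zero_mul]
      | add s t hs ht => simp only [map_add, add_mul, tensor_add_mul, hs, ht]
      | tmul x y z =>
        simp [contractBetaAlpha_tmul_comul_mul, contractBetaAlpha_mul_assoc,
          contractBetaAlpha_phi, smul_smul, mul_comm]
  rw [qElt, hlhs, comulLeft_phi_mul_tmulOne_phi_inv, hrhs, counitMiddle_phi, counitRight_phi_inv,
    one_mul]

/-! ### Existence of integrals -/

/-- The map `x ↦ q Δ(x)` is inverted by `pTwist`. -/
theorem pTwist_qElt_mul_comul (h : H) : pTwist k H (qElt k H * Δ h) = h ⊗ₜ 1 := by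
  have key : ∀ (u : H ⊗[k] H) (x y : H), pTwist k H (x ⊗ₜ y * u) =
      Δ x * pTwist k H u * (1 ⊗ₜ σ y) := by
    intro u x y
    induction u using TensorProduct.induction_on with
    | zero => simp
    | add u v hu hv => simp only [map_add, mul_add, add_mul, hu, hv]
    | tmul s t => simp [S_mul, mul_assoc]
  have key' : ∀ w : H ⊗[k] H, pTwist k H (w * Δ h) = pTwist k H w * (h ⊗ₜ 1) := by
    intro w
    induction w using TensorProduct.induction_on with
    | zero => simp
    | add u v hu hv => simp only [map_add, add_mul, hu, hv]
    | tmul x y => rw [key, pTwist_comul, pTwist_tmul]; simp [mul_assoc]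
  rw [key', pTwist_qElt, one_mul]

section Untwist

variable {V : Type*} [AddCommGroup V] [Module k V] (ρ : H →ₐ[k] Module.End k V)

/-- The action of `H ⊗ H` on `H ⊗ V` given by left multiplication and `ρ`. -/
noncomputable def tensorAction : H ⊗[k] H →ₐ[k] Module.End k (H ⊗[k] V) :=
  Module.endTensorEndAlgHom.comp (Algebra.TensorProduct.map (Algebra.lmul k H) ρ)

omit [QuasiHopfAlgebra k H] in
@[simp] theorem tensorAction_tmul (x y h : H) (v : V) :
    tensorAction ρ (x ⊗ₜ y) (h ⊗ₜ v) = (x * h) ⊗ₜ ρ y v := rfl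

/-- The linear map `x ⊗ y ↦ x ⊗ ρ(S(y)) v`. -/
noncomputable def antipodeAction (v : V) : H ⊗[k] H →ₗ[k] H ⊗[k] V :=
  TensorProduct.map LinearMap.id ((LinearMap.applyₗ v ∘ₗ ρ.toLinearMap) ∘ₗ (σ).toLinearMap)

@[simp] theorem antipodeAction_tmul (v : V) (x y : H) :
    antipodeAction ρ v (x ⊗ₜ y) = x ⊗ₜ ρ (σ y) v := rfl

/-- The map `h ⊗ v ↦ ∑ q₁ h₁ ⊗ ρ(S(q₂ h₂)) v`, which turns the diagonal action of `H` on `H ⊗ V`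
into left multiplication on the first factor. -/
noncomputable def untwist : H ⊗[k] V →ₗ[k] H ⊗[k] V :=
  TensorProduct.lift (LinearMap.mk₂ k (fun h v => antipodeAction ρ v (qElt k H * Δ h))
    (fun x x' v => by simp [mul_add]) (fun c x v => by simp)
    (fun x v v' => by
      generalize qElt k H * Δ x = w
      induction w using TensorProduct.induction_on with
      | zero => simp
      | add a b ha hb => simp only [map_add, ha, hb]; abel
      | tmul a b => simp [tmul_add])
    (fun c x v => by
      generalize qElt k H * Δ x = w
      induction w using TensorProduct.induction_on with
      | zero => simp
      | add a b ha hb => simp only [map_add, ha, hb, smul_add]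
      | tmul a b => simp))

@[simp] theorem untwist_tmul (h : H) (v : V) :
    untwist ρ (h ⊗ₜ v) = antipodeAction ρ v (qElt k H * Δ h) := rfl

/-- The inverse `h ⊗ v ↦ Δ(h) p (1 ⊗ v)` of `untwist`. -/
noncomputable def twist : H ⊗[k] V →ₗ[k] H ⊗[k] V :=
  TensorProduct.lift (LinearMap.mk₂ k (fun h v => tensorAction ρ (Δ h * pElt k H) (1 ⊗ₜ v))
    (fun x x' v => by simp [add_mul]) (fun c x v => by simp)
    (fun x v v' => by simp [tmul_add]) (fun c x v => by simp))

@[simp] theorem twist_tmul (h : H) (v : V) :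
    twist ρ (h ⊗ₜ v) = tensorAction ρ (Δ h * pElt k H) (1 ⊗ₜ v) := rfl

theorem twist_untwist (z : H ⊗[k] V) : twist ρ (untwist ρ z) = z := by
  have key : ∀ (w : H ⊗[k] H) (v : V), twist ρ (antipodeAction ρ v w) =
      tensorAction ρ (pTwist k H w) (1 ⊗ₜ v) := by
    intro w v
    induction w using TensorProduct.induction_on with
    | zero => simp
    | add a b ha hb => simp only [map_add, ha, hb, LinearMap.add_apply]
    | tmul a b => simp
  induction z using TensorProduct.induction_on with
  | zero => simp
  | add a b ha hb => simp only [map_add, ha, hb]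
  | tmul h v => rw [untwist_tmul, key, pTwist_qElt_mul_comul]; simp

theorem untwist_tensorAction_comul (a : H) (z : H ⊗[k] V) :
    untwist ρ (tensorAction ρ (Δ a) z) = tensorAction ρ (a ⊗ₜ 1) (untwist ρ z) := by
  have key : ∀ (w : H ⊗[k] H) (t : H) (v : V), antipodeAction ρ (ρ t v) w =
      antipodeAction ρ v ((1 ⊗ₜ (σ).symm t) * w) := by
    intro w t v
    induction w using TensorProduct.induction_on with
    | zero => simp
    | add a b ha hb => simp only [map_add, mul_add, ha, hb]
    | tmul a b => simp [S_mul]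
  have key' : ∀ (w : H ⊗[k] H) (v : V), antipodeAction ρ v ((a ⊗ₜ 1) * w) =
      tensorAction ρ (a ⊗ₜ 1) (antipodeAction ρ v w) := by
    intro w v
    induction w using TensorProduct.induction_on with
    | zero => simp
    | add a b ha hb => simp only [map_add, mul_add, ha, hb]
    | tmul a b => simp
  induction z using TensorProduct.induction_on with
  | zero => simp
  | add a b ha hb => simp only [map_add, ha, hb]
  | tmul h v =>
    have hu : ∀ u : H ⊗[k] H, untwist ρ (tensorAction ρ u (h ⊗ₜ v)) =
        antipodeAction ρ v (qTwist k H u * Δ h) := by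
      intro u
      induction u using TensorProduct.induction_on with
      | zero => simp
      | add a b ha hb => simp only [map_add, add_mul, LinearMap.add_apply, ha, hb]
      | tmul s t =>
        rw [tensorAction_tmul, untwist_tmul, key, qTwist_tmul, map_mul Δ, mul_assoc, mul_assoc]
    rw [hu, qTwist_comul, mul_assoc, key', untwist_tmul]

end Untwist

variable (k H) in
/-- The left action of `H` on its dual, `(y f)(v) = f(S(y) v)`. -/
noncomputable def dualAction : H →ₐ[k] Module.End k (Module.Dual k H) :=
  AlgHom.ofLinearMap
    (LinearMap.mk₂ k (fun (y : H) (f : Module.Dual k H) => f ∘ₗ LinearMap.mulLeft k (σ y))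
      (fun x y f => by ext; simp [add_mul]) (fun c x f => by ext; simp)
      (fun x f g => by ext; simp) (fun c x f => by ext; simp))
    (by ext; simp [S_one]) (fun x y => by ext; simp [S_mul])

@[simp] theorem dualAction_apply (y v : H) (f : Module.Dual k H) :
    dualAction k H y f v = f (σ y * v) := rfl

/-- The invariant `∑ β eᵢ ⊗ eⁱ` of `H ⊗ H*` is nonzero; untwisting it and evaluating the second
factor yields left integrals, not all of them zero. -/
theorem exists_isLeftIntegral [FiniteDimensional k H] : ∃ l : H, l ≠ 0 ∧ IsLeftIntegral k l := by
  let G : H ⊗[k] Module.Dual k H ≃ₗ[k] (H →ₗ[k] H) :=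
    (TensorProduct.comm k H (Module.Dual k H)).trans (dualTensorHomEquiv k H H)
  have hG : ∀ (x v : H) (f : Module.Dual k H), G (x ⊗ₜ f) v = f v • x := by
    intro x v f
    simp [G]
  have hGact : ∀ (x y v : H) (z : H ⊗[k] Module.Dual k H),
      G (tensorAction (dualAction k H) (x ⊗ₜ y) z) v = x * G z (σ y * v) := by
    intro x y v z
    induction z using TensorProduct.induction_on with
    | zero => simp
    | add a b ha hb => simp only [map_add, LinearMap.add_apply, mul_add, ha, hb]
    | tmul h f => simp [hG]
  let z := G.symm (LinearMap.mulLeft k β)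
  have hz : ∀ a, tensorAction (dualAction k H) (Δ a) z = ε a • z := by
    intro a
    apply G.injective
    ext v
    have key : ∀ u : H ⊗[k] H, G (tensorAction (dualAction k H) u z) v =
        contractBeta k H u * v := by
      intro u
      induction u using TensorProduct.induction_on with
      | zero => simp
      | add a b ha hb => simp only [map_add, LinearMap.add_apply, add_mul, ha, hb]
      | tmul x y => rw [hGact]; simp [z, mul_assoc]
    rw [key, contractBeta_comul]
    simp [z]
  have hz0 : z ≠ 0 := by
    intro h
    have h1 : (β : H) = 0 := by
      have := LinearMap.congr_fun (G.symm.map_eq_zero_iff.1 h) 1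
      simpa using this
    have h2 := counit_alpha_mul_counit_beta (k := k) (H := H)
    simp [h1] at h2
  set y := untwist (dualAction k H) z with hy
  have hy0 : y ≠ 0 := by
    intro h
    apply hz0
    rw [← twist_untwist (dualAction k H) z, ← hy, h, map_zero]
  have hya : ∀ a : H, tensorAction (dualAction k H) (a ⊗ₜ 1) y = ε a • y := by
    intro a
    rw [hy, ← untwist_tensorAction_comul, hz, map_smul]
  have hGy : G y ≠ 0 := by simpa using hy0
  obtain ⟨v, hv⟩ : ∃ v, G y v ≠ 0 := by
    by_contra! h
    exact hGy (LinearMap.ext h)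
  refine ⟨G y v, hv, fun a => ?_⟩
  have h := congrArg (fun w => G w v) (hya a)
  simpa [hGact, S_one] using h

theorem IsLeftIntegral.isRightIntegral_S {l : H} (hl : IsLeftIntegral k l) :
    IsRightIntegral k (σ l) := fun a => by
  obtain ⟨b, rfl⟩ := (σ).surjective a
  rw [← S_mul, hl b, map_smul, counit_S]

theorem IsRightIntegral.isLeftIntegral_S {r : H} (hr : IsRightIntegral k r) :
    IsLeftIntegral k (σ r) := fun a => by
  obtain ⟨b, rfl⟩ := (σ).surjective a
  rw [← S_mul, hr b, map_smul, counit_S]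

/-! ### The Frobenius element of a two-sided integral -/

section Slice

variable {A B : Type*} [Ring A] [Algebra k A] [Ring B] [Algebra k B]

/-- The slice map `f ⊗ id : A ⊗ B → B` of a functional `f` on `A`. -/
noncomputable def slice (f : Module.Dual k A) : A ⊗[k] B →ₗ[k] B :=
  TensorProduct.lid k B ∘ₗ TensorProduct.map f LinearMap.id

omit [QuasiHopfAlgebra k H]

@[simp] theorem slice_tmul (f : Module.Dual k A) (a : A) (b : B) :
    slice f (a ⊗ₜ[k] b) = f a • b := rfl

theorem slice_tmul_one_mul (f : Module.Dual k A) (a : A) (w : A ⊗[k] B) :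
    slice f ((a ⊗ₜ 1) * w) = slice (f ∘ₗ LinearMap.mulLeft k a) w := by
  induction w using TensorProduct.induction_on with
  | zero => simp
  | add x y hx hy => simp only [map_add, mul_add, hx, hy]
  | tmul x y => simp

theorem slice_mul_tmul_one (f : Module.Dual k A) (a : A) (w : A ⊗[k] B) :
    slice f (w * (a ⊗ₜ 1)) = slice (f ∘ₗ LinearMap.mulRight k a) w := by
  induction w using TensorProduct.induction_on with
  | zero => simp
  | add x y hx hy => simp only [map_add, add_mul, hx, hy]
  | tmul x y => simp

theorem slice_one_tmul_mul (f : Module.Dual k A) (b : B) (w : A ⊗[k] B) :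
    slice f ((1 ⊗ₜ b) * w) = b * slice f w := by
  induction w using TensorProduct.induction_on with
  | zero => simp
  | add x y hx hy => simp only [map_add, mul_add, hx, hy]
  | tmul x y => simp

theorem slice_mul_one_tmul (f : Module.Dual k A) (b : B) (w : A ⊗[k] B) :
    slice f (w * (1 ⊗ₜ b)) = slice f w * b := by
  induction w using TensorProduct.induction_on with
  | zero => simp
  | add x y hx hy => simp only [map_add, add_mul, hx, hy]
  | tmul x y => simp

theorem slice_map {C : Type*} [Ring C] [Algebra k C] (f : Module.Dual k A) (g : B →ₐ[k] C)
    (w : A ⊗[k] B) :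
    slice f (Algebra.TensorProduct.map (AlgHom.id k A) g w) = g (slice f w) := by
  induction w using TensorProduct.induction_on with
  | zero => simp
  | add x y hx hy => simp only [map_add, hx, hy]
  | tmul x y => simp

theorem eq_zero_of_slice_eq_zero {w : A ⊗[k] B} (h : ∀ f : Module.Dual k A, slice f w = 0) :
    w = 0 := by
  classical
  let b := Module.Basis.ofVectorSpace k A
  have key : ∀ (v : A ⊗[k] B) i,
      TensorProduct.equivFinsuppOfBasisLeft b v i = slice (b.coord i) v := by
    intro v i
    induction v using TensorProduct.induction_on with
    | zero => simp
    | add x y hx hy => simp only [map_add, Finsupp.add_apply, hx, hy]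
    | tmul x y => simp
  apply (TensorProduct.equivFinsuppOfBasisLeft b).injective
  ext i
  rw [key, h, map_zero, Finsupp.zero_apply]

end Slice

/-- The element `q Δ(l) p` of `H ⊗ H`. For a two-sided integral `l` it is a Casimir element up to
the antipode, and contracting it with functionals identifies `H*` with `H`. -/
noncomputable def frobeniusElt (l : H) : H ⊗[k] H := qElt k H * Δ l * pElt k H

theorem IsLeftIntegral.qTwist_mul_comul {l : H} (hl : IsLeftIntegral k l) (u : H ⊗[k] H) :
    qTwist k H u * Δ l = (1 ⊗ₜ (σ).symm (Algebra.TensorProduct.lid k H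
      (Algebra.TensorProduct.map ε (AlgHom.id k H) u))) * (qElt k H * Δ l) := by
  induction u using TensorProduct.induction_on with
  | zero => simp
  | add x y hx hy => simp only [map_add, add_mul, tmul_add, hx, hy]
  | tmul x y =>
    rw [qTwist_tmul, mul_assoc, ← map_mul Δ, hl x]
    simp [mul_assoc]

theorem IsRightIntegral.comul_mul_pTwist {l : H} (hl : IsRightIntegral k l) (u : H ⊗[k] H) :
    Δ l * pTwist k H u = Δ l * pElt k H * (1 ⊗ₜ σ (Algebra.TensorProduct.lid k H
      (Algebra.TensorProduct.map ε (AlgHom.id k H) u))) := by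
  induction u using TensorProduct.induction_on with
  | zero => simp
  | add x y hx hy => simp only [map_add, mul_add, tmul_add, hx, hy]
  | tmul x y =>
    rw [pTwist_tmul, mul_assoc, ← mul_assoc (Δ l), ← map_mul Δ, hl x]
    simp [mul_assoc]

theorem IsLeftIntegral.tmul_one_mul_frobeniusElt {l : H} (hl : IsLeftIntegral k l) (a : H) :
    (a ⊗ₜ 1) * frobeniusElt l = (1 ⊗ₜ[k] (σ).symm a) * frobeniusElt l := by
  have h := hl.qTwist_mul_comul (Δ a)
  rw [counit_comul, qTwist_comul] at h
  rw [frobeniusElt, ← mul_assoc, ← mul_assoc, h, ← mul_assoc, ← mul_assoc, ← mul_assoc]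

theorem IsRightIntegral.frobeniusElt_mul_tmul_one {l : H} (hl : IsRightIntegral k l) (a : H) :
    frobeniusElt l * (a ⊗ₜ 1) = frobeniusElt l * (1 ⊗ₜ[k] σ a) := by
  have h := hl.comul_mul_pTwist (Δ a)
  rw [counit_comul, pTwist_comul] at h
  rw [frobeniusElt, mul_assoc, mul_assoc, h]
  simp only [mul_assoc]

/-- `Δ(l)` is recovered from `q Δ(l) p` by multiplications in the second tensor factor. -/
theorem exists_comul_eq_mul_frobeniusElt_mul {l : H} (hl : IsLeftIntegral k l)
    (hr : IsRightIntegral k l) :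
    ∃ m m' : H, Δ l = (1 ⊗ₜ m) * frobeniusElt l * (1 ⊗ₜ m') := by
  have h1 := hl.qTwist_mul_comul (pElt k H)
  have h2 := hr.comul_mul_pTwist (qElt k H)
  rw [qTwist_pElt, one_mul] at h1
  rw [pTwist_qElt, mul_one] at h2
  generalize (σ).symm _ = m at h1
  generalize σ _ = m' at h2
  refine ⟨m, m', h1.trans ?_⟩
  nth_rw 1 [h2]
  simp only [frobeniusElt, mul_assoc]

theorem map_counit_qElt : Algebra.TensorProduct.rid k k H
    (Algebra.TensorProduct.map (AlgHom.id k H) ε (qElt k H)) = ε α • 1 := by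
  have key : ∀ t, Algebra.TensorProduct.rid k k H
      (Algebra.TensorProduct.map (AlgHom.id k H) ε (qMap k H t)) =
      ε α • Algebra.TensorProduct.rid k k H
        (Algebra.TensorProduct.map (AlgHom.id k H) ε (counitMiddle k H t)) := by
    intro t
    induction t using threefold_induction with
    | zero => simp
    | add s t hs ht => simp only [map_add, smul_add, hs, ht]
    | tmul a b c =>
      simp [counit_S_symm, counit_S, smul_smul]
      ring_nf
  rw [qElt, key, counitMiddle_phi]
  simp

theorem map_counit_pElt : Algebra.TensorProduct.rid k k H
    (Algebra.TensorProduct.map (AlgHom.id k H) ε (pElt k H)) = ε β • 1 := by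
  have key : ∀ t, Algebra.TensorProduct.rid k k H
      (Algebra.TensorProduct.map (AlgHom.id k H) ε (pMap k H t)) =
      ε β • Algebra.TensorProduct.rid k k H
        (Algebra.TensorProduct.map (AlgHom.id k H) ε (counitMiddle k H t)) := by
    intro t
    induction t using threefold_induction with
    | zero => simp
    | add s t hs ht => simp only [map_add, smul_add, hs, ht]
    | tmul a b c =>
      simp [counit_S, smul_smul]
      ring_nf
  rw [pElt, key, counitMiddle_phi_inv]
  simp

theorem map_id_counit_frobeniusElt (l : H) : Algebra.TensorProduct.rid k k H
    (Algebra.TensorProduct.map (AlgHom.id k H) ε (frobeniusElt l)) = l := by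
  rw [frobeniusElt, map_mul, map_mul, map_mul, map_mul, map_counit_qElt, map_counit_pElt,
    comul_counit]
  simp [smul_smul, mul_comm (ε β), counit_alpha_mul_counit_beta]

theorem counit_slice (f : Module.Dual k H) (w : H ⊗[k] H) :
    ε (slice f w) = f (Algebra.TensorProduct.rid k k H
      (Algebra.TensorProduct.map (AlgHom.id k H) ε w)) := by
  induction w using TensorProduct.induction_on with
  | zero => simp
  | add x y hx hy => simp only [map_add, hx, hy]
  | tmul x y => simp [mul_comm]

theorem slice_counit_mul (w w' : H ⊗[k] H) :
    slice (ε).toLinearMap (w * w') = slice (ε).toLinearMap w * slice (ε).toLinearMap w' := by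
  have h : ∀ v : H ⊗[k] H, slice (ε).toLinearMap v = Algebra.TensorProduct.lid k H
    (Algebra.TensorProduct.map ε (AlgHom.id k H) v) := fun v => rfl
  rw [h, h, h, map_mul, map_mul]

theorem slice_counit_frobeniusElt {l : H} (hl : IsLeftIntegral k l) (hr : IsRightIntegral k l) :
    slice (ε).toLinearMap (frobeniusElt l) = l := by
  have h : slice (ε).toLinearMap (Δ l) = l := counit_comul l
  rw [frobeniusElt, slice_counit_mul, slice_counit_mul, h, hl, smul_mul_assoc, hr, smul_smul,
    counit_slice, counit_slice, map_counit_qElt, map_counit_pElt]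
  simp [counit_alpha_mul_counit_beta]

section Quotient

variable {B : Type*} [Ring B] [Algebra k B] (π : H →ₐ[k] B)

/-- Quasi-coassociativity carries `(id ⊗ π)(Δ l) = 0` over to `(id ⊗ ψ)(Δ l) = 0` with
`ψ = (id ⊗ π) ∘ Δ`. -/
theorem map_comul_of_map_comul_eq_zero {l : H}
    (h : Algebra.TensorProduct.map (AlgHom.id k H) π (Δ l) = 0) :
    Algebra.TensorProduct.map (AlgHom.id k H)
      ((Algebra.TensorProduct.map (AlgHom.id k H) π).comp Δ) (Δ l) = 0 := by
  let P : H ⊗[k] (H ⊗[k] H) →ₐ[k] H ⊗[k] (H ⊗[k] B) :=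
    Algebra.TensorProduct.map (AlgHom.id k H) (Algebra.TensorProduct.map (AlgHom.id k H) π)
  have h1 : ∀ w : H ⊗[k] H, Algebra.TensorProduct.map (AlgHom.id k H)
      ((Algebra.TensorProduct.map (AlgHom.id k H) π).comp Δ) w =
      P (Algebra.TensorProduct.map (AlgHom.id k H) Δ w) := by
    intro w
    induction w using TensorProduct.induction_on with
    | zero => simp
    | add x y hx hy => simp only [map_add, hx, hy]
    | tmul x y => rfl
  have h2 : ∀ w : H ⊗[k] H, P (Algebra.TensorProduct.assoc k k k H H H
      (Algebra.TensorProduct.map Δ (AlgHom.id k H) w)) = Algebra.TensorProduct.assoc k k k H H B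
      (Algebra.TensorProduct.map Δ (AlgHom.id k B)
        (Algebra.TensorProduct.map (AlgHom.id k H) π w)) := by
    intro w
    induction w using TensorProduct.induction_on with
    | zero => simp
    | add x y hx hy => simp only [map_add, hx, hy]
    | tmul x y =>
      simp only [Algebra.TensorProduct.map_tmul, AlgHom.id_apply]
      generalize Δ x = u
      induction u using TensorProduct.induction_on with
      | zero => simp
      | add x y hx hy => simp only [map_add, add_tmul, hx, hy]
      | tmul x y => rfl
  have h3 : Algebra.TensorProduct.map (AlgHom.id k H) Δ (Δ l) =
      Φ * Algebra.TensorProduct.assoc k k k H H H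
        (Algebra.TensorProduct.map Δ (AlgHom.id k H) (Δ l)) * Φi := by
    rw [← quasi_coassoc, tensor_mul_assoc, Units.mul_inv, mul_one]
  rw [h1, h3, map_mul, map_mul, h2, h, map_zero, map_zero, tensor_mul_zero, tensor_zero_mul]

theorem map_comul_slice_eq_zero {l : H} (hl : IsLeftIntegral k l) (hr : IsRightIntegral k l)
    (h : Algebra.TensorProduct.map (AlgHom.id k H) π (frobeniusElt l) = 0)
    (f : Module.Dual k H) :
    Algebra.TensorProduct.map (AlgHom.id k H) π (Δ (slice f (frobeniusElt l))) = 0 := by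
  obtain ⟨m, m', hm⟩ := exists_comul_eq_mul_frobeniusElt_mul hl hr
  have h1 : Algebra.TensorProduct.map (AlgHom.id k H) π (Δ l) = 0 := by
    rw [hm, map_mul, map_mul, h, mul_zero, zero_mul]
  have h2 := map_comul_of_map_comul_eq_zero π h1
  have h3 := slice_map f ((Algebra.TensorProduct.map (AlgHom.id k H) π).comp Δ) (frobeniusElt l)
  rw [AlgHom.comp_apply] at h3
  have h4 : Algebra.TensorProduct.map (AlgHom.id k H)
      ((Algebra.TensorProduct.map (AlgHom.id k H) π).comp Δ) (frobeniusElt l) = 0 := by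
    rw [frobeniusElt, map_mul, map_mul, h2, tensor_mul_zero, tensor_zero_mul]
  rw [← h3, h4, map_zero]

theorem counit_smul_map_alpha {x : H}
    (h : Algebra.TensorProduct.map (AlgHom.id k H) π (Δ x) = 0) : ε x • π α = 0 := by
  have key : ∀ w : H ⊗[k] H, π (contractAlpha k H w) = LinearMap.mul' k B
      (TensorProduct.map (π.toLinearMap ∘ₗ LinearMap.mulRight k α ∘ₗ (σ).toLinearMap)
        LinearMap.id (Algebra.TensorProduct.map (AlgHom.id k H) π w)) := by
    intro w
    induction w using TensorProduct.induction_on with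
    | zero => simp
    | add x y hx hy => simp only [map_add, hx, hy]
    | tmul x y => simp
  rw [← map_smul, ← contractAlpha_comul, key, h, map_zero, map_zero]

theorem eq_zero_of_map_comul_eq_zero {x : H} {η : B →ₐ[k] k} (hη : η.comp π = ε)
    (h : Algebra.TensorProduct.map (AlgHom.id k H) π (Δ x) = 0) : x = 0 := by
  have key : ∀ w : H ⊗[k] H, Algebra.TensorProduct.map (AlgHom.id k H) ε w =
      Algebra.TensorProduct.map (AlgHom.id k H) η
        (Algebra.TensorProduct.map (AlgHom.id k H) π w) := by
    intro w
    induction w using TensorProduct.induction_on with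
    | zero => simp
    | add x y hx hy => simp only [map_add, hx, hy]
    | tmul x y => simp [← hη]
  rw [← comul_counit (k := k) x, key, h, map_zero, map_zero]

end Quotient

/-- The slices `f(E₁) E₂` of `E = q Δ(l) p`, for an integral `l`. They form a left
ideal if `l` is a left integral, and a two-sided ideal if `l` is two-sided. -/
noncomputable def sliceIdeal {l : H} (hl : IsLeftIntegral k l) : Ideal H where
  carrier := {x | ∃ f : Module.Dual k H, slice f (frobeniusElt l) = x}
  zero_mem' := ⟨0, by simp [slice]⟩
  add_mem' := by
    rintro _ _ ⟨f, rfl⟩ ⟨g, rfl⟩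
    exact ⟨f + g, by simp [slice, TensorProduct.map_add_left]⟩
  smul_mem' := by
    rintro a _ ⟨f, rfl⟩
    refine ⟨f ∘ₗ LinearMap.mulLeft k (σ a), ?_⟩
    rw [← slice_tmul_one_mul, hl.tmul_one_mul_frobeniusElt, slice_one_tmul_mul,
      LinearEquiv.symm_apply_apply, smul_eq_mul]

theorem IsRightIntegral.isTwoSided_sliceIdeal {l : H} (hl : IsLeftIntegral k l)
    (hr : IsRightIntegral k l) : (sliceIdeal hl).IsTwoSided where
  mul_mem_of_left := by
    rintro _ a ⟨f, rfl⟩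
    refine ⟨f ∘ₗ LinearMap.mulRight k ((σ).symm a), ?_⟩
    rw [← slice_mul_tmul_one, hr.frobeniusElt_mul_tmul_one, slice_mul_one_tmul,
      LinearEquiv.apply_symm_apply]

/-- The ideal `I` of slices is a left coideal containing `l`. If `ε` is nonzero on `I`, then
`S(x₁) α x₂ = ε(x) α` puts `α` into `I`, hence also `1 = X β S(Y) α Z`; otherwise `x = x₁ ε(x₂)`
vanishes on `I`, contrary to `l ≠ 0`. -/
theorem exists_slice_frobeniusElt_eq_one {l : H} (h0 : l ≠ 0) (hl : IsLeftIntegral k l)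
    (hr : IsRightIntegral k l) : ∃ ω : H →ₗ[k] k, slice ω (frobeniusElt l) = 1 := by
  have := IsRightIntegral.isTwoSided_sliceIdeal hl hr
  let π := Ideal.Quotient.mkₐ k (sliceIdeal hl)
  have hπ : ∀ x, π x = 0 ↔ x ∈ sliceIdeal hl := fun x => Ideal.Quotient.eq_zero_iff_mem
  have hE : Algebra.TensorProduct.map (AlgHom.id k H) π (frobeniusElt l) = 0 := by
    refine eq_zero_of_slice_eq_zero fun f => ?_
    rw [slice_map, hπ]
    exact ⟨f, rfl⟩
  have hx := map_comul_slice_eq_zero π hl hr hE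
  by_cases hε : ∀ x ∈ sliceIdeal hl, ε x = 0
  · refine absurd (eq_zero_of_map_comul_eq_zero π (x := l)
      (η := Ideal.Quotient.liftₐ (sliceIdeal hl) ε hε) ?_ ?_) h0
    · exact Ideal.Quotient.liftₐ_comp _ _ _
    · simpa [slice_counit_frobeniusElt hl hr] using hx (ε).toLinearMap
  · push Not at hε
    obtain ⟨_, ⟨f, rfl⟩, hf⟩ := hε
    have hα : π α = 0 := (smul_eq_zero.1 (counit_smul_map_alpha π (hx f))).resolve_left hf
    have key : ∀ t, π (contractBetaAlpha k H t) = 0 := by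
      intro t
      induction t using threefold_induction with
      | zero => simp
      | add s t hs ht => rw [map_add, map_add, hs, ht, add_zero]
      | tmul a b c => simp [hα]
    have h1 := key Φ
    rwa [contractBetaAlpha_phi, hπ] at h1

/-! ### Integrals, the modulus and symmetry -/

theorem IsLeftIntegral.slice_comp_mulLeft_frobeniusElt {l : H} (hl : IsLeftIntegral k l)
    {ω : H →ₗ[k] k} (hω : slice ω (frobeniusElt l) = 1) (a : H) :
    slice (ω ∘ₗ LinearMap.mulLeft k a) (frobeniusElt l) = (σ).symm a := by
  rw [← slice_tmul_one_mul, hl.tmul_one_mul_frobeniusElt, slice_one_tmul_mul, hω, mul_one]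

theorem IsRightIntegral.slice_comp_mulRight_frobeniusElt {l : H} (hr : IsRightIntegral k l)
    {ω : H →ₗ[k] k} (hω : slice ω (frobeniusElt l) = 1) (a : H) :
    slice (ω ∘ₗ LinearMap.mulRight k a) (frobeniusElt l) = σ a := by
  rw [← slice_mul_tmul_one, hr.frobeniusElt_mul_tmul_one, slice_mul_one_tmul, hω, one_mul]

/-- A nonzero two-sided integral makes `H` a Frobenius algebra, with `S⁻²` as modular
automorphism. -/
theorem exists_nondegenerate_of_two_sided [FiniteDimensional k H] {l : H} (h0 : l ≠ 0)
    (hl : IsLeftIntegral k l) (hr : IsRightIntegral k l) :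
    ∃ ω : H →ₗ[k] k, NondegenerateFunctional ω ∧ ∀ a b : H, ω (a * b) = ω (σ (σ b) * a) := by
  obtain ⟨ω, hω⟩ := exists_slice_frobeniusElt_eq_one h0 hl hr
  refine ⟨ω, ⟨fun a ha => ?_, fun a ha => ?_⟩, fun a b => ?_⟩
  · have h := hl.slice_comp_mulLeft_frobeniusElt hω a
    have h1 : ω ∘ₗ LinearMap.mulLeft k a = 0 := LinearMap.ext fun b => by simpa using ha b
    rw [h1] at h
    simpa [slice] using h.symm
  · have h := hr.slice_comp_mulRight_frobeniusElt hω a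
    have h1 : ω ∘ₗ LinearMap.mulRight k a = 0 := LinearMap.ext fun b => by simpa using ha b
    rw [h1] at h
    simpa [slice] using h.symm
  · -- Contraction with `E` is a surjection `H* → H`, hence injective, and both functionals
    -- `ω(· b)` and `ω(S²(b) ·)` are sent to `S(b)`.
    let F : Module.Dual k H →ₗ[k] H :=
      { toFun := fun f => slice f (frobeniusElt l)
        map_add' := fun f g => by simp [slice, TensorProduct.map_add_left]
        map_smul' := fun c f => by simp [slice, TensorProduct.map_smul_left] }
    have hF : Function.Injective F := by
      rw [LinearMap.injective_iff_surjective_of_finrank_eq_finrank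
        (Subspace.dual_finrank_eq (K := k) (V := H))]
      intro a
      refine ⟨ω ∘ₗ LinearMap.mulLeft k (σ a), ?_⟩
      exact (hl.slice_comp_mulLeft_frobeniusElt hω _).trans ((σ).symm_apply_apply a)
    have h : F (ω ∘ₗ LinearMap.mulRight k b) = F (ω ∘ₗ LinearMap.mulLeft k (σ (σ b))) :=
      (hr.slice_comp_mulRight_frobeniusElt hω b).trans
        ((hl.slice_comp_mulLeft_frobeniusElt hω _).trans ((σ).symm_apply_apply _)).symm
    exact LinearMap.congr_fun (hF h) a

/-- If `ω(E₁) E₂ = 1`, then `ω(l) = 1` and `ω(S(l) E₁) E₂ = l`; for `S(l) = c l` the left side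
of the latter is `c ω(l) ε(E₁) E₂ = c l`. -/
theorem eq_one_of_S_eq_smul {l : H} (h0 : l ≠ 0) (hl : IsLeftIntegral k l)
    (hr : IsRightIntegral k l) {c : k} (hc : σ l = c • l) : c = 1 := by
  obtain ⟨ω, hω⟩ := exists_slice_frobeniusElt_eq_one h0 hl hr
  have h1 : ω l = 1 := by
    have h := counit_slice ω (frobeniusElt l)
    rw [hω, map_id_counit_frobeniusElt, map_one] at h
    exact h.symm
  have h2 := hl.slice_comp_mulLeft_frobeniusElt hω (σ l)
  have h3 : ω ∘ₗ LinearMap.mulLeft k (σ l) = c • (ε).toLinearMap := by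
    ext b
    simp [hc, hr b, h1]
  have h4 : slice (c • (ε).toLinearMap) (frobeniusElt l) = c • l := by
    rw [slice, TensorProduct.map_smul_left, LinearMap.comp_smul, LinearMap.smul_apply]
    exact congrArg (c • ·) (slice_counit_frobeniusElt hl hr)
  rw [h3, h4, LinearEquiv.symm_apply_apply] at h2
  exact smul_left_injective k h0 (h2.trans (one_smul k l).symm)

variable (k H) in
/-- The square of the antipode as an algebra automorphism. -/
noncomputable def antipodeSq : H ≃ₐ[k] H :=
  AlgEquiv.ofLinearEquiv ((σ).trans σ) (by simp [S_one]) (fun a b => by simp [S_mul])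

@[simp] theorem antipodeSq_apply (a : H) : antipodeSq k H a = σ (σ a) := rfl

theorem isUnimodular_of_two_sided [FiniteDimensional k H] {l : H} (h0 : l ≠ 0)
    (hl : IsLeftIntegral k l) (hr : IsRightIntegral k l) : IsUnimodular k H := by
  obtain ⟨ω, hω, hS⟩ := exists_nondegenerate_of_two_sided h0 hl hr
  refine ⟨ω, (antipodeSq k H).symm, hω, fun a b => ?_, fun a => ?_⟩
  · rw [hS b, ← antipodeSq_apply, AlgEquiv.apply_symm_apply]
  · rw [AlgEquiv.symm_symm, antipodeSq_apply, counit_S, counit_S]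

/-- In the unimodular case the left and the right integrals form the same line, spanned by the
element representing `ε` through a nondegenerate functional. -/
theorem IsUnimodular.exists_integral [FiniteDimensional k H] (h : IsUnimodular k H) :
    ∃ u : H, u ≠ 0 ∧ IsLeftIntegral k u ∧ IsRightIntegral k u ∧
      (∀ l : H, IsLeftIntegral k l → ∃ c : k, l = c • u) ∧
      ∀ r : H, IsRightIntegral k r → ∃ c : k, r = c • u := by
  obtain ⟨ω, θ, hω, hθ, hε⟩ := h
  obtain ⟨u, hu⟩ := exists_mul_of_nondegenerate hω (ε).toLinearMap
  replace hu : ∀ b, ω (b * u) = ε b := fun b => (hu b).symm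
  have huθ : ∀ b, ω (u * b) = ε b := by
    intro b
    conv_lhs => rw [← θ.apply_symm_apply b]
    rw [← hθ, hu, ← hε]
  refine ⟨u, ?_, fun a => ?_, fun a => ?_, fun l hl => ⟨ω l, ?_⟩, fun r hr => ⟨ω r, ?_⟩⟩
  · rintro rfl
    have h := hu 1
    rw [mul_zero, map_zero, map_one] at h
    exact zero_ne_one h
  · refine sub_eq_zero.1 (hω.2 _ fun b => ?_)
    rw [mul_sub, map_sub, ← mul_assoc, hu, mul_smul_comm, map_smul, hu, map_mul, smul_eq_mul,
      mul_comm, sub_self]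
  · refine sub_eq_zero.1 (hω.1 _ fun b => ?_)
    rw [sub_mul, map_sub, mul_assoc, huθ, smul_mul_assoc, map_smul, huθ, map_mul, smul_eq_mul,
      sub_self]
  · refine sub_eq_zero.1 (hω.2 _ fun b => ?_)
    rw [mul_sub, map_sub, hl b, map_smul, mul_smul_comm, map_smul, hu, smul_eq_mul, smul_eq_mul,
      mul_comm, sub_self]
  · refine sub_eq_zero.1 (hω.1 _ fun b => ?_)
    rw [sub_mul, map_sub, hr b, map_smul, smul_mul_assoc, map_smul, huθ, smul_eq_mul, smul_eq_mul,
      mul_comm, sub_self]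

theorem IsUnimodular.exists_S_invariant_integral [FiniteDimensional k H] (h : IsUnimodular k H) :
    ∃ u : H, (∀ l : H, IsLeftIntegral k l → ∃ c : k, l = c • u) ∧
      (∀ r : H, IsRightIntegral k r → ∃ c : k, r = c • u) ∧ IsSInvariant k u := by
  obtain ⟨u, h0, hl, hr, hL, hR⟩ := h.exists_integral
  refine ⟨u, hL, hR, ?_⟩
  obtain ⟨c, hc⟩ := hR _ hl.isRightIntegral_S
  rw [IsSInvariant, hc, eq_one_of_S_eq_smul h0 hl hr hc, one_smul]

theorem IsSInvariant.smul {u : H} (hu : IsSInvariant k u) (c : k) : IsSInvariant k (c • u) := by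
  rw [IsSInvariant, map_smul, hu]

theorem isUnimodular_of_isSymmetricFrobenius (h : IsSymmetricFrobenius k H) :
    IsUnimodular k H := by
  obtain ⟨τ, hτ, hcomm⟩ := h
  exact ⟨τ, AlgEquiv.refl, hτ, hcomm, fun a => rfl⟩

/-- Two nondegenerate functionals differ by a unit, which conjugates the modular automorphism
`S⁻²` of one of them into the trivial modular automorphism of a trace. -/
theorem isInnerAutomorphism_S_sq_of_isSymmetricFrobenius [FiniteDimensional k H]
    (h : IsSymmetricFrobenius k H) : IsInnerAutomorphism fun x : H => σ (σ x) := by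
  obtain ⟨l, h0, hl, hr, -⟩ := (isUnimodular_of_isSymmetricFrobenius h).exists_integral
  obtain ⟨ω, hω, hS⟩ := exists_nondegenerate_of_two_sided h0 hl hr
  obtain ⟨τ, hτ, hcomm⟩ := h
  obtain ⟨u, hu⟩ := exists_mul_of_nondegenerate hτ ω
  obtain ⟨v, hv⟩ := exists_mul_of_nondegenerate hω τ
  have huv : v * u = 1 := by
    refine sub_eq_zero.1 (hτ.2 _ fun b => ?_)
    rw [mul_sub, map_sub, mul_one, ← mul_assoc, ← hu, ← hv, sub_self]
  have hvu : u * v = 1 := by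
    refine sub_eq_zero.1 (hω.2 _ fun b => ?_)
    rw [mul_sub, map_sub, mul_one, ← mul_assoc, ← hv, ← hu, sub_self]
  refine ⟨⟨v, u, huv, hvu⟩, fun x => ?_⟩
  have key : x * u = u * σ (σ x) := by
    refine sub_eq_zero.1 (hτ.2 _ fun b => ?_)
    rw [mul_sub, map_sub, ← mul_assoc, ← hu, hS, hu, mul_assoc, hcomm, mul_assoc, sub_self]
  change σ (σ x) = v * x * u
  rw [mul_assoc, key, ← mul_assoc, huv, one_mul]

/-- If `S²` is conjugation by `g`, then `x ↦ ω(g x)` is a nondegenerate trace for any nondegenerate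
`ω` with modular automorphism `S⁻²`. -/
theorem isSymmetricFrobenius_of_isUnimodular [FiniteDimensional k H] (h : IsUnimodular k H)
    (hinner : IsInnerAutomorphism fun x : H => σ (σ x)) : IsSymmetricFrobenius k H := by
  obtain ⟨l, h0, hl, hr, -⟩ := h.exists_integral
  obtain ⟨ω, hω, hS⟩ := exists_nondegenerate_of_two_sided h0 hl hr
  obtain ⟨g, hg⟩ := hinner
  refine ⟨ω ∘ₗ LinearMap.mulLeft k (g : H), ⟨fun a ha => ?_, fun a ha => ?_⟩, fun a b => ?_⟩
  · have h1 : (g : H) * a = 0 := hω.1 _ fun b => by simpa [mul_assoc] using ha b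
    simpa using h1
  · refine hω.2 _ fun b => ?_
    simpa [mul_assoc] using ha (((g⁻¹ : Hˣ) : H) * b)
  · simp only [LinearMap.comp_apply, LinearMap.mulLeft_apply]
    have h1 := hS ((g : H) * b) a
    rw [show σ (σ a) = _ from hg a] at h1
    simpa [mul_assoc] using h1.symm

end
end QuasiHopfAlgebra

theorem proposition5 (k H : Type*) [Field k] [Ring H] [Algebra k H] [FiniteDimensional k H]
    [QuasiHopfAlgebra k H] :
    List.TFAE [
      QuasiHopfAlgebra.IsUnimodular k H,
      ∃ l : H, l ≠ 0 ∧ QuasiHopfAlgebra.IsLeftIntegral k l ∧ QuasiHopfAlgebra.IsSInvariant k l,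
      ∀ l : H, l ≠ 0 → QuasiHopfAlgebra.IsLeftIntegral k l → QuasiHopfAlgebra.IsSInvariant k l,
      ∃ r : H, r ≠ 0 ∧ QuasiHopfAlgebra.IsRightIntegral k r ∧ QuasiHopfAlgebra.IsSInvariant k r,
      ∀ r : H, r ≠ 0 → QuasiHopfAlgebra.IsRightIntegral k r →
        QuasiHopfAlgebra.IsSInvariant k r] ∧
    (IsSymmetricFrobenius k H ↔
      QuasiHopfAlgebra.IsUnimodular k H ∧
      IsInnerAutomorphism fun x : H =>
        QuasiHopfAlgebra.S (k := k) (QuasiHopfAlgebra.S (k := k) x)) := by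
  refine ⟨?_, fun h => ⟨QuasiHopfAlgebra.isUnimodular_of_isSymmetricFrobenius h,
    QuasiHopfAlgebra.isInnerAutomorphism_S_sq_of_isSymmetricFrobenius h⟩,
    fun h => QuasiHopfAlgebra.isSymmetricFrobenius_of_isUnimodular h.1 h.2⟩
  tfae_have 1 → 3 := by
    intro h l _ hl
    obtain ⟨u, hL, -, hu⟩ := h.exists_S_invariant_integral
    obtain ⟨c, rfl⟩ := hL l hl
    exact hu.smul c
  tfae_have 1 → 5 := by
    intro h r _ hr
    obtain ⟨u, -, hR, hu⟩ := h.exists_S_invariant_integral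
    obtain ⟨c, rfl⟩ := hR r hr
    exact hu.smul c
  tfae_have 3 → 2 := by
    intro h
    obtain ⟨l, h0, hl⟩ := QuasiHopfAlgebra.exists_isLeftIntegral (k := k) (H := H)
    exact ⟨l, h0, hl, h l h0 hl⟩
  tfae_have 5 → 4 := by
    intro h
    obtain ⟨l, h0, hl⟩ := QuasiHopfAlgebra.exists_isLeftIntegral (k := k) (H := H)
    have h1 : QuasiHopfAlgebra.S (k := k) l ≠ 0 := by simpa using h0
    exact ⟨_, h1, hl.isRightIntegral_S, h _ h1 hl.isRightIntegral_S⟩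
  tfae_have 2 → 1 := by
    rintro ⟨l, h0, hl, hS⟩
    have hr := hl.isRightIntegral_S
    rw [hS] at hr
    exact QuasiHopfAlgebra.isUnimodular_of_two_sided h0 hl hr
  tfae_have 4 → 1 := by
    rintro ⟨r, h0, hr, hS⟩
    have hl := hr.isLeftIntegral_S
    rw [hS] at hl
    exact QuasiHopfAlgebra.isUnimodular_of_two_sided h0 hl hr
  tfae_finish
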